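/- Let $0\le p\le d$ be integers and let $E\subseteq\mathbb{R}^d$ be any $p$-dimensional unit cube, i.e. $E=\{x+\sum_{i=1}^p t_ie_i : 0\le t_i\le 1\}$ for some $x\in\mathbb{R}^d$ and orthonormal $e_1,\dots,e_p\in\mathbb{R}^d$. Let $\mathrm{Gr}(p,d)$ be the Grassmannian of $p$-dimensional linear subspaces of $\mathbb{R}^d$, equipped with its uniform probability measure $dL$ (the rotation-invariant one). For $L\in\mathrm{Gr}(p,d)$ let $E|_L$ be the orthogonal projection of $E$ onto $L$, let $\mathrm{Vol}_p$ denote $p$-dimensional volume, and define the $j$-th projection moment $$M_j^{p,d}=\int_{\mathrm{Gr}(p,d)}\mathrm{Vol}_p(E|_L)^j\,dL .$$ Then $$M_1^{p,d}=\frac{\Gamma\left(\frac{p+1}{2}\right)\Gamma\left(\frac{d-p+1}{2}\right)}{\Gamma\left(\frac12\right)\Gamma\left(\frac{d+1}{2}\right)},\qquad M_2^{p,d}=\frac{1}{\binom{d}{p}}=\frac{p!\,(d-p)!}{d!}.$$ -/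

import Mathlib

open MeasureTheory

namespace RandomProjection

/-- The linear Grassmannian: the `p`-dimensional linear subspaces of `ℝ^d`. -/
def Grass (p d : ℕ) : Type :=
  {L : Submodule ℝ (EuclideanSpace ℝ (Fin d)) // Module.finrank ℝ L = p}

/-- The usual topology of the Grassmannian: a plane `L` is identified with the orthogonal
projection of `ℝ^d` onto `L`. -/
noncomputable instance (p d : ℕ) : TopologicalSpace (Grass p d) :=
  TopologicalSpace.induced
    (fun L : Grass p d => (L.1.starProjection :
      EuclideanSpace ℝ (Fin d) →L[ℝ] EuclideanSpace ℝ (Fin d))) inferInstance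

noncomputable instance (p d : ℕ) : MeasurableSpace (Grass p d) := borel _

instance (p d : ℕ) : BorelSpace (Grass p d) := ⟨rfl⟩

/-- The orthogonal group `O(d)`, with its topology as a set of matrices. -/
abbrev O (d : ℕ) : Type := Matrix.orthogonalGroup (Fin d) ℝ

instance (d : ℕ) : MeasurableSpace (O d) := borel _

instance (d : ℕ) : BorelSpace (O d) := ⟨rfl⟩

instance (d : ℕ) : CompactSpace (O d) := by
  refine isCompact_iff_compactSpace.mp ?_
  have hbox : IsCompact (Set.univ.pi fun _ : Fin d => Set.univ.pi fun _ : Fin d =>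
      Metric.closedBall (0 : ℝ) 1) :=
    isCompact_univ_pi fun _ => isCompact_univ_pi fun _ => isCompact_closedBall 0 1
  refine IsCompact.of_isClosed_subset hbox (isClosed_unitary (R := Matrix (Fin d) (Fin d) ℝ)) ?_
  intro U hU i _ j _
  simpa using entry_norm_bound_of_unitary hU i j

/-- The Haar probability measure of the orthogonal group. -/
noncomputable def haarO (d : ℕ) : Measure (O d) := Measure.haarMeasure ⊤

instance (d : ℕ) : IsProbabilityMeasure (haarO d) :=
  ⟨Measure.haarMeasure_self (K₀ := (⊤ : TopologicalSpace.PositiveCompacts (O d)))⟩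

/-- The linear isometry of `ℝ^d` given by an orthogonal matrix. -/
noncomputable def isometryOf {d : ℕ} (U : O d) :
    EuclideanSpace ℝ (Fin d) ≃ₗᵢ[ℝ] EuclideanSpace ℝ (Fin d) :=
  Unitary.linearIsometryEquiv
    ⟨Matrix.toEuclideanCLM (𝕜 := ℝ) (n := Fin d) U.1, Unitary.map_mem _ U.2⟩

theorem isometryOf_apply {d : ℕ} (U : O d) (x : EuclideanSpace ℝ (Fin d)) :
    isometryOf U x = WithLp.toLp 2 (Matrix.mulVec U.1 x.ofLp) := rfl

/-- The plane `U L`, the image of `L` under the orthogonal matrix `U`. -/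
noncomputable def rotate {p d : ℕ} (U : O d) (L : Grass p d) : Grass p d :=
  ⟨L.1.map (isometryOf U).toLinearEquiv.toLinearMap,
    (LinearEquiv.finrank_map_eq (isometryOf U).toLinearEquiv L.1).trans L.2⟩

/-- The coordinate `p`-plane spanned by the first `p` standard basis vectors of `ℝ^d`. -/
noncomputable def coordPlane {p d : ℕ} (h : p ≤ d) : Grass p d :=
  ⟨Submodule.span ℝ (Set.range fun i : Fin p =>
      EuclideanSpace.basisFun (Fin d) ℝ (Fin.castLE h i)), by
    rw [finrank_span_eq_card]
    · simp
    · exact ((EuclideanSpace.basisFun (Fin d) ℝ).orthonormal.linearIndependent).comp _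
        (Fin.castLE_injective h)⟩

/-- The uniform probability measure of the Grassmannian: the law of `U L₀` for a coordinate
plane `L₀` and a Haar distributed orthogonal matrix `U`. -/
noncomputable def uniform {p d : ℕ} (h : p ≤ d) : Measure (Grass p d) :=
  (haarO d).map fun U => rotate U (coordPlane h)

/-- The `p`-dimensional volume of the orthogonal projection of `E` onto the `p`-plane `L`,
with respect to the Lebesgue measure of the Euclidean space `L`. -/
noncomputable def projVol {p d : ℕ} (L : Grass p d) (E : Set (EuclideanSpace ℝ (Fin d))) : ℝ :=
  (volume : Measure L.1).real (L.1.orthogonalProjectionOnto '' E)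

/-- `E` is a `p`-dimensional unit cube in `ℝ^d`, in an arbitrary position. -/
def IsUnitCube {d : ℕ} (p : ℕ) (E : Set (EuclideanSpace ℝ (Fin d))) : Prop :=
  ∃ (x : EuclideanSpace ℝ (Fin d)) (e : Fin p → EuclideanSpace ℝ (Fin d)), Orthonormal ℝ e ∧
    E = {y | ∃ t : Fin p → ℝ, (∀ i, 0 ≤ t i ∧ t i ≤ 1) ∧ y = x + ∑ i, t i • e i}

/-- The `j`-th projection moment of `E`: the average of the `j`-th power of the `p`-volume of the
projection of `E` onto a uniformly random `p`-plane. -/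
noncomputable def moment {p d : ℕ} (h : p ≤ d) (E : Set (EuclideanSpace ℝ (Fin d))) (j : ℕ) : ℝ :=
  ∫ L, projVol L E ^ j ∂(uniform h)

theorem starProjection_rotate {p d : ℕ} (U : O d) (L : Grass p d) :
    (rotate U L).1.starProjection =
      Matrix.toEuclideanCLM (𝕜 := ℝ) (n := Fin d) U.1 * L.1.starProjection *
        Matrix.toEuclideanCLM (𝕜 := ℝ) (n := Fin d) (star U.1) := by
  have hsymm (x : EuclideanSpace ℝ (Fin d)) : (isometryOf U).symm x =
      Matrix.toEuclideanCLM (𝕜 := ℝ) (n := Fin d) (star U.1) x := by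
    rw [LinearIsometryEquiv.symm_apply_eq]
    change x = (Matrix.toEuclideanCLM (𝕜 := ℝ) (n := Fin d) U.1 *
      Matrix.toEuclideanCLM (𝕜 := ℝ) (n := Fin d) (star U.1)) x
    rw [← map_mul, Unitary.mul_star_self_of_mem U.2, map_one]
    rfl
  ext1 x
  refine (Submodule.starProjection_map_apply (isometryOf U) L.1 x).trans ?_
  rw [hsymm]
  rfl

theorem continuous_toEuclideanCLM (d : ℕ) :
    Continuous (Matrix.toEuclideanCLM (𝕜 := ℝ) (n := Fin d)) :=
  LinearMap.continuous_of_finiteDimensional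
    (Matrix.toEuclideanCLM (𝕜 := ℝ) (n := Fin d)).toAlgEquiv.toLinearMap

theorem continuous_rotate_left {p d : ℕ} (L : Grass p d) :
    Continuous fun U : O d => rotate U L := by
  refine continuous_induced_rng.mpr ?_
  have h := continuous_toEuclideanCLM d
  refine Continuous.congr (f := fun U : O d =>
    Matrix.toEuclideanCLM (𝕜 := ℝ) (n := Fin d) U.1 * L.1.starProjection *
      Matrix.toEuclideanCLM (𝕜 := ℝ) (n := Fin d) (star U.1)) ?_
    fun U => (starProjection_rotate U L).symm
  exact ((h.comp continuous_subtype_val).mul continuous_const).mul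
    (h.comp (continuous_star.comp continuous_subtype_val))

theorem continuous_rotate_right {p d : ℕ} (U : O d) :
    Continuous fun L : Grass p d => rotate U L := by
  refine continuous_induced_rng.mpr ?_
  refine Continuous.congr (f := fun L : Grass p d =>
    Matrix.toEuclideanCLM (𝕜 := ℝ) (n := Fin d) U.1 * L.1.starProjection *
      Matrix.toEuclideanCLM (𝕜 := ℝ) (n := Fin d) (star U.1)) ?_
    fun L => (starProjection_rotate U L).symm
  exact (continuous_const.mul continuous_induced_dom).mul continuous_const

theorem rotate_mul {p d : ℕ} (U V : O d) (L : Grass p d) :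
    rotate (U * V) L = rotate U (rotate V L) := by
  apply Subtype.ext
  simp only [rotate]
  rw [← Submodule.map_comp]
  congr 1
  ext x i
  simp [isometryOf_apply, Matrix.mulVec_mulVec]

instance {p d : ℕ} (h : p ≤ d) : IsProbabilityMeasure (uniform h) :=
  Measure.isProbabilityMeasure_map (continuous_rotate_left _).measurable.aemeasurable

/-- The uniform measure is invariant under all rotations and reflections. -/
theorem uniform_map_rotate {p d : ℕ} (h : p ≤ d) (U : O d) :
    (uniform h).map (rotate U) = uniform h := by
  have hU : (haarO d).map (fun V => U * V) = haarO d := by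
    have : (haarO d).IsMulLeftInvariant := by unfold haarO; infer_instance
    exact map_mul_left_eq_self (haarO d) U
  have hl := (continuous_rotate_left (coordPlane h)).measurable
  conv_rhs => rw [uniform, ← hU]
  rw [uniform, Measure.map_map (continuous_rotate_right U).measurable hl,
    Measure.map_map hl (continuous_const_mul U).measurable]
  congr 1
  funext V
  exact (rotate_mul U V _).symm

end RandomProjection

/-! Projecting a cube with edges `e i` onto the plane spanned by the orthonormal vectors `U f_k`
gives a parallelepiped of volume `|det ⟪e i, U f_k⟫|`. So the `j`-th moment is the Haar average of
the `j`-th power of this determinant (`moment_eq_toReal_frameMoment`). By invariance, this average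
is a constant `c` shared by all orthonormal families. For arbitrary vectors `a i` the determinant
factors through an orthonormal basis of their span, giving `gramVol a ^ j * c`
(`frameMoment_eq_gramVol_mul`).

To find `c`, take the `a i` to be independent standard Gaussians in `ℝ^d` and apply Tonelli
(`frameMoment_frame`). For fixed `U`, the entries `⟪a i, U f_k⟫` form a `p × p` Gaussian matrix, so
`c` is the ratio of the Gaussian volume moments in `ℝ^p` and `ℝ^d`. Base times height turns each of
these into a product of moments of Gaussian norms (`gramMoment_succ`), which are Gamma quotients.
With `N` the product `normMomentProd j`, this yields `c = N(p) N(d-p) / N(d)`. For `j = 1` the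
product `N` telescopes; for `j = 2` it is a factorial. -/

namespace RandomProjection

open ProbabilityTheory Module
open scoped RealInnerProductSpace

/-! ### Standard Gaussian measures and the moments of their norms. -/

section Gaussian

variable {E F : Type*} [NormedAddCommGroup E] [InnerProductSpace ℝ E] [FiniteDimensional ℝ E]
  [MeasurableSpace E] [BorelSpace E] [NormedAddCommGroup F] [InnerProductSpace ℝ F]
  [FiniteDimensional ℝ F] [MeasurableSpace F] [BorelSpace F]

/-- A map whose transpose is isometric pushes the standard Gaussian measure to the standard
Gaussian measure. -/
theorem measurePreserving_stdGaussian {T : E → F} {S : F → E} (hT : Measurable T)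
    (hTS : ∀ x t, ⟪T x, t⟫ = ⟪x, S t⟫) (hS : ∀ t, ‖S t‖ = ‖t‖) :
    MeasurePreserving T (stdGaussian E) (stdGaussian F) := by
  refine ⟨hT, ?_⟩
  have : IsProbabilityMeasure ((stdGaussian E).map T) :=
    Measure.isProbabilityMeasure_map hT.aemeasurable
  refine Measure.ext_of_charFun ?_
  ext t
  rw [charFun_apply, integral_map hT.aemeasurable (Measurable.aestronglyMeasurable (by fun_prop))]
  simp_rw [hTS]
  rw [← charFun_apply, charFun_stdGaussian, charFun_stdGaussian, hS]

theorem measurePreserving_orthogonalProjectionOnto (W : Submodule ℝ E) :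
    MeasurePreserving W.orthogonalProjectionOnto (stdGaussian E) (stdGaussian W) :=
  measurePreserving_stdGaussian (S := fun t => (t : E)) (by fun_prop)
    (fun x t => by simp) fun t => rfl

/-- Taking coordinates along an orthonormal family preserves standard Gaussian measures. -/
theorem measurePreserving_inner_orthonormal {ι : Type*} [Fintype ι] {f : ι → E}
    (hf : Orthonormal ℝ f) :
    MeasurePreserving (fun x : E => WithLp.toLp 2 fun k => ⟪f k, x⟫) (stdGaussian E)
      (stdGaussian (EuclideanSpace ℝ ι)) := by
  refine measurePreserving_stdGaussian (S := fun t => ∑ k, t k • f k) (by fun_prop) ?_ ?_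
  · intro x t
    simp [PiLp.inner_apply, inner_sum, inner_smul_right, real_inner_comm]
  · intro t
    rw [← sq_eq_sq₀ (norm_nonneg _) (norm_nonneg _), ← real_inner_self_eq_norm_sq,
      hf.inner_sum, EuclideanSpace.real_norm_sq_eq]
    simp [sq]

variable (E) in
/-- The normalizing constant of the standard Gaussian density. -/
noncomputable def gaussianConst : ℝ := ((2 * Real.pi) ^ (finrank ℝ E / 2 : ℝ))⁻¹

omit [FiniteDimensional ℝ E] [MeasurableSpace E] [BorelSpace E] in
theorem gaussianConst_pos : 0 < gaussianConst E := by
  unfold gaussianConst; positivity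

/-- Both sides are finite measures with the same characteristic function. The density makes polar
coordinates available for the norm moments. -/
theorem stdGaussian_eq_withDensity :
    stdGaussian E = volume.withDensity fun x : E =>
      ENNReal.ofReal (gaussianConst E * Real.exp (-(1 / 2) * ‖x‖ ^ 2)) := by
  have hmeas : Measurable fun x : E =>
      ENNReal.ofReal (gaussianConst E * Real.exp (-(1 / 2) * ‖x‖ ^ 2)) := by fun_prop
  have hb : 0 < ((1 / 2 : ℝ) : ℂ).re := by rw [Complex.ofReal_re]; norm_num
  have hint : Integrable fun x : E => gaussianConst E * Real.exp (-(1 / 2) * ‖x‖ ^ 2) := by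
    refine Integrable.const_mul ?_ _
    have h := (GaussianFourier.integrable_cexp_neg_mul_sq_norm_add hb 0 (0 : E)).re
    refine h.congr (ae_of_all _ fun x => ?_)
    simp only [zero_mul, add_zero]
    have : -((1 / 2 : ℝ) : ℂ) * (‖x‖ : ℂ) ^ 2 = ((-(1 / 2) * ‖x‖ ^ 2 : ℝ) : ℂ) := by
      push_cast; ring
    rw [this, ← Complex.ofReal_exp]
    rfl
  have : IsFiniteMeasure (volume.withDensity fun x : E =>
      ENNReal.ofReal (gaussianConst E * Real.exp (-(1 / 2) * ‖x‖ ^ 2))) :=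
    isFiniteMeasure_withDensity_ofReal hint.2
  refine Measure.ext_of_charFun ?_
  ext t
  rw [charFun_stdGaussian, charFun_apply, integral_withDensity_eq_integral_toReal_smul hmeas
    (ae_of_all _ fun x => ENNReal.ofReal_lt_top)]
  have h1 (x : E) : (ENNReal.ofReal (gaussianConst E * Real.exp (-(1 / 2) * ‖x‖ ^ 2))).toReal •
      Complex.exp (⟪x, t⟫ * Complex.I) = (gaussianConst E : ℂ) *
        Complex.exp (-((1 / 2 : ℝ) : ℂ) * ‖x‖ ^ 2 + Complex.I * ⟪t, x⟫) := by
    rw [ENNReal.toReal_ofReal (mul_nonneg gaussianConst_pos.le (Real.exp_nonneg _)),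
      Complex.real_smul, Complex.exp_add, real_inner_comm]
    push_cast
    ring_nf
  simp_rw [h1]
  rw [integral_const_mul, GaussianFourier.integral_cexp_neg_mul_sq_norm_add hb]
  have h2 : ((Real.pi : ℂ) / ((1 / 2 : ℝ) : ℂ)) ^ ((finrank ℝ E : ℂ) / 2) =
      (((2 * Real.pi) ^ (finrank ℝ E / 2 : ℝ) : ℝ) : ℂ) := by
    rw [Complex.ofReal_cpow (by positivity)]
    push_cast
    congr 1
    ring
  have h3 : ((gaussianConst E : ℝ) : ℂ) * (((2 * Real.pi) ^ (finrank ℝ E / 2 : ℝ) : ℝ) : ℂ) = 1 := by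
    rw [← Complex.ofReal_mul, gaussianConst, inv_mul_cancel₀ (by positivity), Complex.ofReal_one]
  rw [h2, ← mul_assoc, h3, one_mul]
  congr 1
  rw [Complex.I_sq]
  push_cast
  ring

/-- The `j`-th moment of the norm of a standard Gaussian vector of `ℝ^n`, for `n ≥ 1`. -/
noncomputable def normMoment (j n : ℕ) : ℝ :=
  2 ^ ((j : ℝ) / 2) * Real.Gamma (((n : ℝ) + j) / 2) / Real.Gamma ((n : ℝ) / 2)

theorem normMoment_pos (j : ℕ) {n : ℕ} (hn : 0 < n) : 0 < normMoment j n := by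
  have : (0 : ℝ) < n := by exact_mod_cast hn
  unfold normMoment
  have h1 := Real.Gamma_pos_of_pos (show 0 < ((n : ℝ) + j) / 2 by positivity)
  have h2 := Real.Gamma_pos_of_pos (show 0 < (n : ℝ) / 2 by positivity)
  positivity

theorem integral_norm_pow_stdGaussian (j : ℕ) (hE : 0 < finrank ℝ E) :
    ∫ x : E, ‖x‖ ^ j ∂stdGaussian E = normMoment j (finrank ℝ E) := by
  have : Nontrivial E := finrank_pos_iff.mp hE
  set n := finrank ℝ E with hn
  have hn0 : (0 : ℝ) < n := by exact_mod_cast hE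
  have hmeas : Measurable fun x : E =>
      ENNReal.ofReal (gaussianConst E * Real.exp (-(1 / 2) * ‖x‖ ^ 2)) := by fun_prop
  -- Polar coordinates for every exponent at once: the case `k = 0`, total mass one, determines the
  -- prefactor, so the volume of the unit ball need not be computed.
  have key (k : ℕ) : ∫ x : E, ‖x‖ ^ k ∂stdGaussian E =
      n * (volume : Measure E).real (Metric.ball 0 1) * gaussianConst E *
        ((1 / 2) ^ (-((n : ℝ) + k) / 2) * (1 / 2) * Real.Gamma (((n : ℝ) + k) / 2)) := by
    rw [stdGaussian_eq_withDensity, integral_withDensity_eq_integral_toReal_smul hmeas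
      (ae_of_all _ fun x => ENNReal.ofReal_lt_top)]
    have h1 (x : E) : (ENNReal.ofReal (gaussianConst E * Real.exp (-(1 / 2) * ‖x‖ ^ 2))).toReal •
        ‖x‖ ^ k = (fun r : ℝ => gaussianConst E * (Real.exp (-(1 / 2) * r ^ 2) * r ^ k)) ‖x‖ := by
      rw [ENNReal.toReal_ofReal (mul_nonneg gaussianConst_pos.le (Real.exp_nonneg _)), smul_eq_mul,
        mul_assoc]
    simp_rw [h1]
    rw [integral_fun_norm_addHaar volume (fun r : ℝ =>
      gaussianConst E * (Real.exp (-(1 / 2) * r ^ 2) * r ^ k)), ← hn]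
    have h2 : ∫ y in Set.Ioi (0 : ℝ), y ^ (n - 1) •
        (gaussianConst E * (Real.exp (-(1 / 2) * y ^ 2) * y ^ k)) =
        gaussianConst E * ∫ y in Set.Ioi (0 : ℝ),
          y ^ ((n : ℝ) + k - 1) * Real.exp (-(1 / 2) * y ^ (2 : ℝ)) := by
      rw [← integral_const_mul]
      refine setIntegral_congr_fun measurableSet_Ioi fun y hy => ?_
      have hy : 0 < y := hy
      have h3 : y ^ ((n : ℝ) + k - 1) = y ^ (n - 1) * y ^ k := by
        rw [← pow_add, ← Real.rpow_natCast]
        congr 1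
        push_cast [Nat.cast_sub (show 1 ≤ n from hE)]
        ring
      simp only [smul_eq_mul]
      rw [h3, Real.rpow_two]
      ring
    rw [h2, integral_rpow_mul_exp_neg_mul_rpow two_pos (by
      have : (0 : ℝ) ≤ k := k.cast_nonneg
      linarith) (by norm_num)]
    simp only [nsmul_eq_mul, smul_eq_mul]
    rw [show (n : ℝ) + k - 1 + 1 = n + k by ring]
    ring
  have hj := key j
  have h0 := key 0
  simp only [pow_zero, integral_const, probReal_univ, smul_eq_mul, mul_one, Nat.cast_zero,
    add_zero] at h0
  have hsplit : (1 / 2 : ℝ) ^ (-((n : ℝ) + j) / 2) =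
      2 ^ ((j : ℝ) / 2) * (1 / 2 : ℝ) ^ (-(n : ℝ) / 2) := by
    rw [one_div, Real.inv_rpow two_pos.le, Real.inv_rpow two_pos.le, ← Real.rpow_neg two_pos.le,
      ← Real.rpow_neg two_pos.le, ← Real.rpow_add two_pos]
    congr 1
    ring
  have hG := (Real.Gamma_pos_of_pos (show 0 < (n : ℝ) / 2 by positivity)).ne'
  rw [hj, hsplit, normMoment, eq_div_iff hG]
  linear_combination (- 2 ^ ((j : ℝ) / 2) * Real.Gamma (((n : ℝ) + j) / 2)) * h0

theorem lintegral_norm_pow_stdGaussian (j : ℕ) (hE : 0 < finrank ℝ E) :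
    ∫⁻ x : E, ENNReal.ofReal (‖x‖ ^ j) ∂stdGaussian E =
      ENNReal.ofReal (normMoment j (finrank ℝ E)) := by
  have h := integral_norm_pow_stdGaussian (E := E) j hE
  have hpos := normMoment_pos j hE
  rw [integral_eq_lintegral_of_nonneg_ae (ae_of_all _ fun x => by positivity)
    (Measurable.aestronglyMeasurable (by fun_prop))] at h
  rw [← h, ENNReal.ofReal_toReal]
  -- An infinite integral would have `toReal` equal to `0`, whereas the moment is positive.
  intro htop
  rw [htop, ENNReal.toReal_top] at h
  exact hpos.ne h

end Gaussian
-- Gram determinants and volume moments of Gaussian families.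
section GramVolume

variable {E : Type*} [NormedAddCommGroup E] [InnerProductSpace ℝ E]

/-- The volume of the parallelepiped spanned by a finite family of vectors. -/
noncomputable def gramVol {ι : Type*} [Fintype ι] [DecidableEq ι] (a : ι → E) : ℝ :=
  √(Matrix.gram ℝ a).det

theorem continuous_gramVol {ι : Type*} [Fintype ι] [DecidableEq ι] :
    Continuous (gramVol : (ι → E) → ℝ) := by
  refine Continuous.sqrt (Continuous.matrix_det ?_)
  refine continuous_matrix fun i j => ?_
  simp only [Matrix.gram_apply]
  fun_prop

theorem gramVol_eq_abs_det {ι : Type*} [Fintype ι] [DecidableEq ι] (f : OrthonormalBasis ι ℝ E)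
    (a : ι → E) : gramVol a = |(Matrix.of fun i k => ⟪a i, f k⟫).det| := by
  have h : Matrix.gram ℝ a = (Matrix.of fun i k => ⟪a i, f k⟫) *
      (Matrix.of fun i k => ⟪a i, f k⟫).transpose := by
    ext i j
    simp only [Matrix.gram_apply, Matrix.mul_apply, Matrix.of_apply, Matrix.transpose_apply]
    rw [← f.sum_inner_mul_inner]
    simp only [real_inner_comm]
  rw [gramVol, h, Matrix.det_mul, Matrix.det_transpose, Real.sqrt_mul_self_eq_abs]

theorem gramVol_ne_zero_iff {ι : Type*} [Fintype ι] [DecidableEq ι] {a : ι → E} :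
    gramVol a ≠ 0 ↔ LinearIndependent ℝ a := by
  rw [gramVol, Real.sqrt_ne_zero (Matrix.posSemidef_gram ℝ a).det_nonneg,
    Matrix.det_gram_ne_zero_iff_linearIndependent]

/-- Squared base times height. Split `x = w + u` along the span of `b` and its complement; the
determinant is additive in the first row. The `w` part vanishes by row dependence, and the `u` part
has a single nonzero entry in that row. -/
theorem det_gram_cons [FiniteDimensional ℝ E] {p : ℕ} (x : E) (b : Fin p → E) :
    (Matrix.gram ℝ (Fin.cons x b : Fin (p + 1) → E)).det =
      ‖(Submodule.span ℝ (Set.range b))ᗮ.orthogonalProjectionOnto x‖ ^ 2 *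
        (Matrix.gram ℝ b).det := by
  set W := Submodule.span ℝ (Set.range b)
  set a : Fin (p + 1) → E := Fin.cons x b with ha
  set w : E := W.starProjection x
  set u : E := Wᗮ.starProjection x
  have hxu : w + u = x := W.starProjection_add_starProjection_orthogonal x
  have hwW : w ∈ W := W.starProjection_apply_mem x
  have huW : u ∈ Wᗮ := Wᗮ.starProjection_apply_mem x
  have hub (i : Fin p) : ⟪u, b i⟫ = 0 :=
    Submodule.inner_left_of_mem_orthogonal (Submodule.subset_span (Set.mem_range_self i)) huW
  have huw : ⟪u, w⟫ = 0 := Submodule.inner_left_of_mem_orthogonal hwW huW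
  have hrow : Matrix.gram ℝ a =
      (Matrix.gram ℝ a).updateRow 0 ((fun k => ⟪w, a k⟫) + fun k => ⟪u, a k⟫) := by
    ext i k
    refine Fin.cases ?_ (fun i => ?_) i
    · simp only [Matrix.updateRow_self, Pi.add_apply, Matrix.gram_apply, ← inner_add_left, hxu]
      simp [ha]
    · rw [Matrix.updateRow_ne (Fin.succ_ne_zero i)]
  have hzero : ((Matrix.gram ℝ a).updateRow 0 fun k => ⟪w, a k⟫).det = 0 := by
    obtain ⟨c, hc⟩ := (Submodule.mem_span_range_iff_exists_fun ℝ).mp hwW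
    by_contra hne
    have hli := Matrix.linearIndependent_rows_of_det_ne_zero hne
    rw [Fintype.linearIndependent_iff] at hli
    -- The dependence among the rows is `-w + ∑ c i • b i = 0`.
    have := hli (Fin.cons (-1) c) (by
      ext k
      simp only [Fin.sum_univ_succ, Fin.cons_zero, Fin.cons_succ,
        Matrix.updateRow_self, Matrix.updateRow_ne (Fin.succ_ne_zero _),
        Pi.smul_apply, Finset.sum_apply, smul_eq_mul, Matrix.gram_apply, Pi.zero_apply]
      rw [← hc, sum_inner]
      simp [ha, inner_smul_left]) 0
    simp at this
  rw [hrow, Matrix.det_updateRow_add, hzero, zero_add, Matrix.det_succ_row_zero,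
    Fin.sum_univ_succ, Finset.sum_eq_zero]
  · have hsub' : ((Matrix.gram ℝ a).updateRow 0 fun k => ⟪u, a k⟫).submatrix Fin.succ
        (Fin.succAbove 0) = Matrix.gram ℝ b := by
      ext i k
      simp [ha]
    rw [hsub']
    have : ⟪u, a 0⟫ = ‖u‖ ^ 2 := by
      rw [ha, Fin.cons_zero, ← real_inner_self_eq_norm_sq]
      conv_lhs => rw [← hxu, inner_add_right, huw, zero_add]
    have hnorm : ‖u‖ = ‖Wᗮ.orthogonalProjectionOnto x‖ := rfl
    simp only [Matrix.updateRow_self, this, hnorm, Fin.val_zero, pow_zero, one_mul, add_zero]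
  · intro k _
    simp [ha, hub]

theorem gramVol_cons [FiniteDimensional ℝ E] {p : ℕ} (x : E) (b : Fin p → E) :
    gramVol (Fin.cons x b : Fin (p + 1) → E) =
      ‖(Submodule.span ℝ (Set.range b))ᗮ.orthogonalProjectionOnto x‖ * gramVol b := by
  rw [gramVol, det_gram_cons, Real.sqrt_mul (sq_nonneg _), Real.sqrt_sq (norm_nonneg _), gramVol]

theorem lintegral_pi_fin_succ {α : Type*} [MeasurableSpace α] (μ : Measure α) [SigmaFinite μ]
    {p : ℕ} {f : (Fin (p + 1) → α) → ENNReal} (hf : Measurable f) :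
    ∫⁻ a, f a ∂Measure.pi (fun _ : Fin (p + 1) => μ) =
      ∫⁻ b, ∫⁻ x, f (Fin.cons x b) ∂μ ∂Measure.pi (fun _ : Fin p => μ) := by
  have h := (measurePreserving_piFinSuccAbove (fun _ : Fin (p + 1) => μ) 0).symm
  rw [← h.lintegral_comp hf, lintegral_prod_symm (fun z => f
    ((MeasurableEquiv.piFinSuccAbove (fun _ => α) 0).symm z)) (hf.comp h.measurable).aemeasurable]
  simp only [MeasurableEquiv.piFinSuccAbove_symm_apply, Fin.insertNthEquiv_zero]
  rfl

variable [FiniteDimensional ℝ E] [MeasurableSpace E] [BorelSpace E]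

variable (E) in
/-- The `j`-th moment of the volume spanned by `p` independent standard Gaussian vectors. -/
noncomputable def gramMoment (j p : ℕ) : ENNReal :=
  ∫⁻ a : Fin p → E, ENNReal.ofReal (gramVol a ^ j) ∂Measure.pi fun _ => stdGaussian E

/-- The product `∏_{m ≤ n} E|g_m|^j` of norm moments of Gaussian vectors of dimension `1, …, n`. -/
noncomputable def normMomentProd (j n : ℕ) : ℝ := ∏ i ∈ Finset.range n, normMoment j (i + 1)

theorem normMomentProd_pos (j n : ℕ) : 0 < normMomentProd j n :=
  Finset.prod_pos fun i _ => normMoment_pos j i.succ_pos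

/-- With the other `p` vectors fixed and independent, the height of the new vector is the norm of a
standard Gaussian in their orthogonal complement, of dimension `finrank ℝ E - p`. -/
theorem gramMoment_succ {j p : ℕ} (hj : j ≠ 0) (hp : p < finrank ℝ E) :
    gramMoment E j (p + 1) =
      ENNReal.ofReal (normMoment j (finrank ℝ E - p)) * gramMoment E j p := by
  have hmeas {q : ℕ} : Measurable fun a : Fin q → E => ENNReal.ofReal (gramVol a ^ j) :=
    (continuous_gramVol.measurable.pow_const j).ennreal_ofReal
  rw [gramMoment, lintegral_pi_fin_succ _ hmeas, gramMoment, ← lintegral_const_mul _ hmeas]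
  refine lintegral_congr fun b => ?_
  simp only [gramVol_cons, mul_pow]
  -- Dependent families need no null-set argument: both sides vanish because `j ≠ 0`.
  by_cases hb : gramVol b = 0
  · simp [hb, hj]
  have hdim : finrank ℝ (Submodule.span ℝ (Set.range b))ᗮ = finrank ℝ E - p := by
    have h1 := finrank_span_eq_card (gramVol_ne_zero_iff.mp hb)
    have h2 := (Submodule.span ℝ (Set.range b)).finrank_add_finrank_orthogonal
    rw [Fintype.card_fin] at h1
    omega
  simp_rw [ENNReal.ofReal_mul (pow_nonneg (norm_nonneg _) j)]
  rw [lintegral_mul_const _ (by fun_prop)]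
  congr 1
  rw [← hdim, ← lintegral_norm_pow_stdGaussian j (by omega)]
  exact (measurePreserving_orthogonalProjectionOnto (Submodule.span ℝ (Set.range b))ᗮ).lintegral_comp
    (f := fun y => ENNReal.ofReal (‖y‖ ^ j)) (by fun_prop)

theorem gramMoment_mul_normMomentProd {j p : ℕ} (hj : j ≠ 0) (hp : p ≤ finrank ℝ E) :
    gramMoment E j p * ENNReal.ofReal (normMomentProd j (finrank ℝ E - p)) =
      ENNReal.ofReal (normMomentProd j (finrank ℝ E)) := by
  induction p with
  | zero => simp [gramMoment, gramVol]
  | succ p ih =>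
    rw [← ih (by omega), gramMoment_succ hj hp]
    obtain ⟨m, hm⟩ : ∃ m, finrank ℝ E - p = m + 1 := ⟨finrank ℝ E - p - 1, by omega⟩
    have hm' : finrank ℝ E - (p + 1) = m := by omega
    have hprod : normMomentProd j (m + 1) = normMomentProd j m * normMoment j (m + 1) :=
      Finset.prod_range_succ _ _
    rw [hm, hm', hprod,
      ENNReal.ofReal_mul (normMomentProd_pos j m).le]
    ring

end GramVolume
-- Determinants against a Haar-random orthonormal frame.
section Haar

/-- The coordinates of the `a i` along `w` are independent standard Gaussian vectors of `ℝ^p`,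
whatever `w` and the ambient space are. -/
theorem lintegral_det_inner_orthonormal {E : Type*} [NormedAddCommGroup E] [InnerProductSpace ℝ E]
    [FiniteDimensional ℝ E] [MeasurableSpace E] [BorelSpace E] (j : ℕ) {p : ℕ} {w : Fin p → E}
    (hw : Orthonormal ℝ w) :
    ∫⁻ a : Fin p → E, ENNReal.ofReal (|(Matrix.of fun i k => ⟪a i, w k⟫).det| ^ j)
      ∂Measure.pi (fun _ => stdGaussian E) = gramMoment (EuclideanSpace ℝ (Fin p)) j p := by
  have hmp := measurePreserving_pi (fun _ : Fin p => stdGaussian E)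
    (fun _ : Fin p => stdGaussian (EuclideanSpace ℝ (Fin p)))
    fun _ => measurePreserving_inner_orthonormal hw
  rw [gramMoment, ← hmp.lintegral_comp
    (continuous_gramVol.measurable.pow_const j).ennreal_ofReal]
  refine lintegral_congr fun a => ?_
  rw [gramVol_eq_abs_det (EuclideanSpace.basisFun (Fin p) ℝ)]
  congr 4
  ext i k
  simp [EuclideanSpace.inner_single_right, real_inner_comm]

variable {d p : ℕ}

instance : SecondCountableTopology (O d) :=
  have : SecondCountableTopology (Matrix (Fin d) (Fin d) ℝ) :=
    inferInstanceAs (SecondCountableTopology (Fin d → Fin d → ℝ))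
  TopologicalSpace.Subtype.secondCountableTopology _

theorem isometryOf_mul (U V : O d) (x : EuclideanSpace ℝ (Fin d)) :
    isometryOf (U * V) x = isometryOf U (isometryOf V x) := by
  simp [isometryOf_apply, Matrix.mulVec_mulVec]

theorem continuous_isometryOf_apply (x : EuclideanSpace ℝ (Fin d)) :
    Continuous fun U : O d => isometryOf U x := by
  simp only [isometryOf_apply]
  exact (PiLp.continuous_toLp 2 _).comp
    (Continuous.matrix_mulVec continuous_subtype_val continuous_const)

/-- The first `p` vectors of the standard basis of `ℝ^d`. -/
noncomputable def frame (h : p ≤ d) (k : Fin p) : EuclideanSpace ℝ (Fin d) :=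
  EuclideanSpace.basisFun (Fin d) ℝ (Fin.castLE h k)

theorem orthonormal_frame (h : p ≤ d) : Orthonormal ℝ (frame h) :=
  (EuclideanSpace.basisFun (Fin d) ℝ).orthonormal.comp _ (Fin.castLE_injective h)

theorem orthonormal_isometryOf_frame (h : p ≤ d) (U : O d) :
    Orthonormal ℝ fun k => isometryOf U (frame h k) :=
  (orthonormal_frame h).comp_linearIsometryEquiv (isometryOf U)

/-- Every orthonormal family is a rotated coordinate frame. -/
theorem exists_isometryOf_frame_eq (h : p ≤ d) {q : Fin p → EuclideanSpace ℝ (Fin d)}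
    (hq : Orthonormal ℝ q) : ∃ V : O d, ∀ i, isometryOf V (frame h i) = q i := by
  set s : Set (Fin d) := {m | (m : ℕ) < p}
  set v : Fin d → EuclideanSpace ℝ (Fin d) := fun m => if hm : (m : ℕ) < p then q ⟨m, hm⟩ else 0
    with hv
  have hs : s.domRestrict v = q ∘ fun m : s => ⟨m.1, m.2⟩ := by
    ext1 m
    have hm : (m.1 : ℕ) < p := m.2
    simp [hv, hm]
  have hon : Orthonormal ℝ (s.domRestrict v) := by
    rw [hs]
    refine hq.comp _ fun m m' hmm => Subtype.ext (Fin.ext ?_)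
    simpa using hmm
  obtain ⟨b, hb⟩ := hon.exists_orthonormalBasis_extension_of_card_eq (by simp)
  refine ⟨⟨(EuclideanSpace.basisFun (Fin d) ℝ).toBasis.toMatrix b,
    OrthonormalBasis.toMatrix_orthonormalBasis_mem_unitary _ _⟩, fun i => ?_⟩
  have hi := hb (Fin.castLE h i) i.2
  have hvi : v (Fin.castLE h i) = q i := by simp [hv]
  rw [← hvi, ← hi]
  ext m
  simp [isometryOf_apply, frame, Basis.toMatrix_apply]

/-- The `j`-th moment of the determinant of a family of `p` vectors against a random
orthonormal frame. -/
noncomputable def frameMoment (h : p ≤ d) (j : ℕ) (a : Fin p → EuclideanSpace ℝ (Fin d)) :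
    ENNReal :=
  ∫⁻ U, ENNReal.ofReal (|(Matrix.of fun i k => ⟪a i, isometryOf U (frame h k)⟫).det| ^ j) ∂haarO d

theorem continuous_det_inner_frame (h : p ≤ d) :
    Continuous fun z : (Fin p → EuclideanSpace ℝ (Fin d)) × O d =>
      (Matrix.of fun i k => ⟪z.1 i, isometryOf z.2 (frame h k)⟫).det := by
  refine Continuous.matrix_det (continuous_matrix fun i k => ?_)
  simp only [Matrix.of_apply]
  exact ((continuous_apply i).comp continuous_fst).inner
    ((continuous_isometryOf_apply _).comp continuous_snd)

/-- Replacing `U` by `V * U` under Haar measure lets `V` cancel from both sides of each inner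
product. -/
theorem frameMoment_isometryOf (h : p ≤ d) (j : ℕ) (V : O d)
    (a : Fin p → EuclideanSpace ℝ (Fin d)) :
    frameMoment h j (fun i => isometryOf V (a i)) = frameMoment h j a := by
  have : (haarO d).IsMulLeftInvariant := by unfold haarO; infer_instance
  rw [frameMoment, ← lintegral_mul_left_eq_self _ V, frameMoment]
  simp only [isometryOf_mul, LinearIsometryEquiv.inner_map_map]

theorem frameMoment_eq_of_orthonormal (h : p ≤ d) (j : ℕ)
    {q : Fin p → EuclideanSpace ℝ (Fin d)} (hq : Orthonormal ℝ q) :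
    frameMoment h j q = frameMoment h j (frame h) := by
  obtain ⟨V, hV⟩ := exists_isometryOf_frame_eq h hq
  rw [← frameMoment_isometryOf h j V (frame h)]
  simp only [hV]

theorem det_inner_eq_zero {E : Type*} [NormedAddCommGroup E] [InnerProductSpace ℝ E]
    {a : Fin p → E} (ha : ¬LinearIndependent ℝ a) (w : Fin p → E) :
    (Matrix.of fun i k => ⟪a i, w k⟫).det = 0 := by
  by_contra hne
  refine ha (LinearIndependent.of_comp (LinearMap.pi fun k => (innerSL ℝ (w k)).toLinearMap) ?_)
  have hrow : (LinearMap.pi fun k => (innerSL ℝ (w k)).toLinearMap) ∘ a =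
      (Matrix.of fun i k => ⟪a i, w k⟫).row := by
    ext i k
    simp [real_inner_comm]
  rw [hrow]
  exact Matrix.linearIndependent_rows_of_det_ne_zero hne

/-- For an orthonormal basis `f` of the span of `a`, the matrix of `a` against the frame is the
matrix of `a` against `f` times that of `f` against the frame. The first determinant is `gramVol a`
up to sign. -/
theorem frameMoment_eq_gramVol_mul (h : p ≤ d) {j : ℕ} (hj : j ≠ 0)
    (a : Fin p → EuclideanSpace ℝ (Fin d)) :
    frameMoment h j a = ENNReal.ofReal (gramVol a ^ j) * frameMoment h j (frame h) := by
  by_cases ha : LinearIndependent ℝ a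
  · set W := Submodule.span ℝ (Set.range a)
    have hdim : finrank ℝ W = p := by simpa using finrank_span_eq_card ha
    let f : OrthonormalBasis (Fin p) ℝ W := (stdOrthonormalBasis ℝ W).reindex (finCongr hdim)
    let b : Fin p → W := fun i => ⟨a i, Submodule.subset_span (Set.mem_range_self i)⟩
    have hq : Orthonormal ℝ fun l => (f l : EuclideanSpace ℝ (Fin d)) :=
      f.orthonormal.comp_linearIsometry W.subtypeₗᵢ
    have hvol : gramVol a = |(Matrix.of fun i l => ⟪b i, f l⟫).det| := by
      rw [← gramVol_eq_abs_det]
      rfl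
    rw [← frameMoment_eq_of_orthonormal h j hq, frameMoment, frameMoment, hvol,
      ← lintegral_const_mul' _ _ ENNReal.ofReal_ne_top]
    refine lintegral_congr fun U => ?_
    rw [← ENNReal.ofReal_mul (by positivity), ← mul_pow, ← abs_mul, ← Matrix.det_mul]
    congr 4
    ext i k
    simp only [Matrix.of_apply, Matrix.mul_apply]
    have hai : a i = ∑ l, ⟪b i, f l⟫ • (f l : EuclideanSpace ℝ (Fin d)) := by
      have := congrArg (W.subtype) (f.sum_repr' (b i))
      simp only [map_sum, map_smul, Submodule.subtype_apply] at this
      simp only [real_inner_comm (f _)]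
      exact this.symm
    rw [hai, sum_inner]
    simp only [real_inner_smul_left]
  · have hv : gramVol a = 0 := by
      by_contra hne
      exact ha (gramVol_ne_zero_iff.mp hne)
    simp [frameMoment, det_inner_eq_zero ha, hv, hj]

/-- The double integral over Gaussian `a` and Haar `U` is evaluated in both orders; values in
`ENNReal` make the swap free of integrability conditions. -/
theorem frameMoment_frame (h : p ≤ d) {j : ℕ} (hj : j ≠ 0) :
    frameMoment h j (frame h) * ENNReal.ofReal (normMomentProd j d) =
      ENNReal.ofReal (normMomentProd j p) * ENNReal.ofReal (normMomentProd j (d - p)) := by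
  have hp : gramMoment (EuclideanSpace ℝ (Fin p)) j p = ENNReal.ofReal (normMomentProd j p) := by
    have := gramMoment_mul_normMomentProd (E := EuclideanSpace ℝ (Fin p)) (p := p) hj (by simp)
    simpa [normMomentProd] using this
  have hd := gramMoment_mul_normMomentProd (E := EuclideanSpace ℝ (Fin d)) (p := p) hj (by simpa)
  rw [finrank_euclideanSpace_fin] at hd
  have hprod : gramMoment (EuclideanSpace ℝ (Fin d)) j p * frameMoment h j (frame h) =
      gramMoment (EuclideanSpace ℝ (Fin p)) j p := by
    rw [gramMoment, ← lintegral_mul_const _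
      (continuous_gramVol.measurable.pow_const j).ennreal_ofReal]
    simp_rw [← frameMoment_eq_gramVol_mul h hj, frameMoment]
    rw [lintegral_lintegral_swap
      ((continuous_det_inner_frame h).abs.pow j).measurable.ennreal_ofReal.aemeasurable]
    simp only [lintegral_det_inner_orthonormal j (orthonormal_isometryOf_frame h _),
      lintegral_const, measure_univ, mul_one]
  rw [← hd, ← hp, ← hprod]
  ring

end Haar
-- From projected cubes to determinants, and the explicit constants.
section Moment

theorem volume_real_parallelepiped {F : Type*} [NormedAddCommGroup F] [InnerProductSpace ℝ F]
    [FiniteDimensional ℝ F] [MeasurableSpace F] [BorelSpace F] {p : ℕ} (hF : finrank ℝ F = p)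
    (v : Fin p → F) : (volume : Measure F).real (parallelepiped v) = gramVol v := by
  let f : OrthonormalBasis (Fin p) ℝ F := (stdOrthonormalBasis ℝ F).reindex (finCongr hF)
  rw [← f.addHaar_eq_volume, measureReal_def, Measure.addHaar_parallelepiped,
    ENNReal.toReal_ofReal (abs_nonneg _), gramVol_eq_abs_det f, Basis.det_apply,
    ← Matrix.det_transpose]
  congr 2
  ext i k
  simp [Basis.toMatrix_apply, f.repr_apply_apply, real_inner_comm]

variable {d p : ℕ}

theorem projVol_cube (L : Grass p d) (x : EuclideanSpace ℝ (Fin d))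
    (e : Fin p → EuclideanSpace ℝ (Fin d)) :
    projVol L {y | ∃ t : Fin p → ℝ, (∀ i, 0 ≤ t i ∧ t i ≤ 1) ∧ y = x + ∑ i, t i • e i} =
      gramVol fun i => L.1.starProjection (e i) := by
  set P := L.1.orthogonalProjectionOnto
  have himage : P '' {y | ∃ t : Fin p → ℝ, (∀ i, 0 ≤ t i ∧ t i ≤ 1) ∧ y = x + ∑ i, t i • e i} =
      (fun z => -P x + z) ⁻¹' parallelepiped fun i => P (e i) := by
    ext z
    simp only [Set.mem_image, Set.mem_ofPred_eq, Set.mem_preimage, mem_parallelepiped_iff]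
    constructor
    · rintro ⟨_, ⟨t, ht, rfl⟩, rfl⟩
      exact ⟨t, ⟨fun i => (ht i).1, fun i => (ht i).2⟩, by simp⟩
    · rintro ⟨t, ht, hz⟩
      refine ⟨x + ∑ i, t i • e i, ⟨t, fun i => ⟨ht.1 i, ht.2 i⟩, rfl⟩, ?_⟩
      rw [map_add, map_sum]
      simp only [map_smul]
      rw [← hz, add_neg_cancel_left]
  rw [projVol, himage, measureReal_def, measure_preimage_add, ← measureReal_def,
    volume_real_parallelepiped L.2]
  rfl

theorem continuous_gramVol_starProjection (e : Fin p → EuclideanSpace ℝ (Fin d)) :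
    Continuous fun L : Grass p d => gramVol fun i => L.1.starProjection (e i) := by
  refine continuous_gramVol.comp (continuous_pi fun i => ?_)
  have happly : Continuous fun T : EuclideanSpace ℝ (Fin d) →L[ℝ] EuclideanSpace ℝ (Fin d) =>
      T (e i) := by fun_prop
  exact happly.comp continuous_induced_dom

/-- The rotated frame is an orthonormal basis of the rotated plane, and projecting onto that plane
does not change inner products with its vectors. -/
theorem gramVol_starProjection_rotate (h : p ≤ d) (U : O d)
    (e : Fin p → EuclideanSpace ℝ (Fin d)) :
    (gramVol fun i => (rotate U (coordPlane h)).1.starProjection (e i)) =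
      |(Matrix.of fun i k => ⟪e i, isometryOf U (frame h k)⟫).det| := by
  set L := rotate U (coordPlane h)
  have hmem (k : Fin p) : isometryOf U (frame h k) ∈ L.1 :=
    Submodule.mem_map_of_mem (Submodule.subset_span (Set.mem_range_self k))
  let w : Fin p → L.1 := fun k => ⟨isometryOf U (frame h k), hmem k⟩
  have hw : Orthonormal ℝ w :=
    (L.1.subtypeₗᵢ.orthonormal_comp_iff).mp (orthonormal_isometryOf_frame h U)
  have hspan : ⊤ ≤ Submodule.span ℝ (Set.range w) :=
    (hw.linearIndependent.span_eq_top_of_card_eq_finrank' (by simp [L.2])).ge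
  let f : OrthonormalBasis (Fin p) ℝ L.1 := OrthonormalBasis.mk hw hspan
  have h1 : (gramVol fun i => L.1.starProjection (e i)) =
      gramVol fun i => L.1.orthogonalProjectionOnto (e i) := rfl
  rw [h1, gramVol_eq_abs_det f]
  congr 2
  ext i k
  simp [f, w]

theorem moment_eq_toReal_frameMoment (h : p ≤ d) (j : ℕ) {E : Set (EuclideanSpace ℝ (Fin d))}
    (hE : IsUnitCube p E) : moment h E j = (frameMoment h j (frame h)).toReal := by
  obtain ⟨x, e, he, rfl⟩ := hE
  simp only [moment, projVol_cube]
  have hmeas : AEStronglyMeasurable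
      (fun L : Grass p d => (gramVol fun i => L.1.starProjection (e i)) ^ j)
      ((haarO d).map fun U => rotate U (coordPlane h)) :=
    ((continuous_gramVol_starProjection e).pow j).aestronglyMeasurable
  rw [uniform, integral_map (continuous_rotate_left _).measurable.aemeasurable hmeas,
    ← frameMoment_eq_of_orthonormal h j he, frameMoment,
    ← integral_eq_lintegral_of_nonneg_ae (ae_of_all _ fun U => by positivity)]
  · simp only [gramVol_starProjection_rotate]
  · exact (((continuous_det_inner_frame h).comp
      (Continuous.prodMk_right e)).abs.pow j).aestronglyMeasurable

theorem moment_eq (h : p ≤ d) {j : ℕ} (hj : j ≠ 0) {E : Set (EuclideanSpace ℝ (Fin d))}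
    (hE : IsUnitCube p E) : moment h E j =
      normMomentProd j p * normMomentProd j (d - p) / normMomentProd j d := by
  rw [eq_div_iff (normMomentProd_pos j d).ne', moment_eq_toReal_frameMoment h j hE]
  have := congrArg ENNReal.toReal (frameMoment_frame h hj)
  simpa only [ENNReal.toReal_mul, ENNReal.toReal_ofReal (normMomentProd_pos j _).le] using this

/-- For `j = 1` each factor is `√2 Γ((m+1)/2) / Γ(m/2)`, so the product telescopes. -/
theorem normMomentProd_one (n : ℕ) : normMomentProd 1 n =
    (2 ^ (1 / 2 : ℝ)) ^ n * Real.Gamma (((n : ℝ) + 1) / 2) / Real.Gamma (1 / 2) := by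
  have hG (m : ℕ) : Real.Gamma (((m : ℝ) + 1) / 2) ≠ 0 :=
    (Real.Gamma_pos_of_pos (by positivity)).ne'
  have h0 : Real.Gamma (1 / 2) ≠ 0 := (Real.Gamma_pos_of_pos (by norm_num)).ne'
  induction n with
  | zero => simp [normMomentProd] at h0 ⊢; rw [div_self h0]
  | succ n ih =>
    have h1 := hG n
    rw [normMomentProd, Finset.prod_range_succ, ← normMomentProd, ih, normMoment]
    push_cast
    field_simp
    rw [pow_succ, mul_comm]

theorem normMomentProd_two (n : ℕ) : normMomentProd 2 n = n.factorial := by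
  induction n with
  | zero => simp [normMomentProd]
  | succ n ih =>
    have h1 : normMoment 2 (n + 1) = n + 1 := by
      have hpos : (0 : ℝ) < ((n : ℝ) + 1) / 2 := by positivity
      have hG := (Real.Gamma_pos_of_pos hpos).ne'
      rw [normMoment]
      push_cast
      rw [show ((n : ℝ) + 1 + 2) / 2 = ((n : ℝ) + 1) / 2 + 1 by ring, Real.Gamma_add_one hpos.ne',
        div_self two_ne_zero, Real.rpow_one]
      field_simp
    rw [normMomentProd, Finset.prod_range_succ, ← normMomentProd, ih, h1, Nat.factorial_succ]
    push_cast
    ring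

end Moment
end RandomProjection

theorem lemma1 (d p : ℕ) (hp : p ≤ d) (E : Set (EuclideanSpace ℝ (Fin d)))
    (hE : RandomProjection.IsUnitCube p E) :
    RandomProjection.moment hp E 1 =
        Real.Gamma (((p : ℝ) + 1) / 2) * Real.Gamma (((d : ℝ) - (p : ℝ) + 1) / 2) /
          (Real.Gamma (1 / 2) * Real.Gamma (((d : ℝ) + 1) / 2)) ∧
      RandomProjection.moment hp E 2 = 1 / (d.choose p : ℝ) ∧
      RandomProjection.moment hp E 2 =
        (p.factorial : ℝ) * ((d - p).factorial : ℝ) / (d.factorial : ℝ) := by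
  have h2 : RandomProjection.moment hp E 2 =
      (p.factorial : ℝ) * ((d - p).factorial : ℝ) / (d.factorial : ℝ) := by
    simp only [RandomProjection.moment_eq hp two_ne_zero hE, RandomProjection.normMomentProd_two]
  refine ⟨?_, ?_, h2⟩
  · have hd : Real.Gamma (((d : ℝ) + 1) / 2) ≠ 0 := (Real.Gamma_pos_of_pos (by positivity)).ne'
    have h0 : Real.Gamma (1 / 2) ≠ 0 := (Real.Gamma_pos_of_pos (by norm_num)).ne'
    -- The powers of `√2` cancel, leaving one uncancelled `Γ(1/2)` in the denominator.
    have hc : (2 ^ (1 / 2 : ℝ) : ℝ) ^ d = (2 ^ (1 / 2 : ℝ)) ^ p * (2 ^ (1 / 2 : ℝ)) ^ (d - p) := by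
      rw [← pow_add, Nat.add_sub_cancel' hp]
    have hc0 : (2 ^ (1 / 2 : ℝ) : ℝ) ≠ 0 := (Real.rpow_pos_of_pos two_pos _).ne'
    simp only [RandomProjection.moment_eq hp one_ne_zero hE, RandomProjection.normMomentProd_one]
    rw [hc, Nat.cast_sub hp]
    generalize (2 ^ (1 / 2 : ℝ) : ℝ) = c at hc0
    field_simp
  · rw [h2, Nat.cast_choose ℝ hp, one_div_div]
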